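/- Let $A_1,A_2,\dots$ be an arbitrary sequence of random multisubsets of $(0,1]$ (finite or countably infinite, with finite multiplicities, such that $|A_n\cap S|$ is a random variable for every Borel set $S\subseteq(0,1]$; cardinalities are counted with multiplicity, and the $A_n$ may be defined on different probability spaces). Let $T_n=\sum_{a\in A_n}a$, summed with multiplicity, and let $L(n)=(L_1(n),L_2(n),\dots)$, where $L_i(n)$ is the $i$-th largest element of $A_n$, counted with multiplicity, if $i\le|A_n|$, and $L_i(n)=0$ if $i>|A_n|$. Assume that $\mathbb P(T_n\le 1)=1$ for every $n$, and that for every $k\ge1$ and all pairwise disjoint closed intervals $I_i=[a_i,b_i]\subset(0,1]$, $i=1,\dots,k$, with $0<a_i<b_i$ and $b_1+\cdots+b_k<1$, $$\liminf_{n\to\infty}\mathbb E\prod_{i=1}^k|A_n\cap I_i|\;\ge\;\prod_{i=1}^k\frac{b_i-a_i}{b_i}.\tag{1}$$ Then $L(n)$ converges in distribution, as a random element of $\mathbb R^{\mathbb N}$ with the product topology, to the Poisson–Dirichlet distribution $\mathrm{PD}(1)$. Here $\mathrm{PD}(1)$ is the law of the sequence obtained by ranking in decreasing order the sequence $G_1=1-U_1,\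 G_2=U_1(1-U_2),\ G_3=U_1U_2(1-U_3),\dots$, where $U_1,U_2,\dots$ are independent and uniformly distributed on $(0,1)$. The same conclusion holds if, in place of (1), one assumes that for every $k\geq 1$ and all such intervals $$\liminf_{n\to\infty}\mathbb E\prod_{i=1}^k|A_n\cap I_i|\;\ge\;\prod_{i=1}^k\log\frac{b_i}{a_i}.$$ -/

import Mathlib

open MeasureTheory ProbabilityTheory Filter
open scoped ENNReal

/-- A finite or countably infinite multisubset of `(0,1]`, given by its multiplicity function;
all multiplicities are finite. -/
structure Multisubset where
  /-- The multiplicity of each real number as an element of the multiset. -/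
  mult : ℝ → ℕ
  support_subset : Function.support mult ⊆ Set.Ioc 0 1
  countable_support : (Function.support mult).Countable

namespace Multisubset

/-- The cardinality `|A ∩ S|`, counting multiplicities (possibly infinite). -/
noncomputable def count (A : Multisubset) (S : Set ℝ) : ℝ≥0∞ :=
  ∑' x : S, (A.mult x : ℝ≥0∞)

/-- The sum of the elements, counting multiplicities (possibly infinite). -/
noncomputable def sum (A : Multisubset) : ℝ≥0∞ :=
  ∑' x : ℝ, (A.mult x : ℝ≥0∞) * ENNReal.ofReal x

/-- The σ-algebra generated by the counts `A ↦ |A ∩ S|` for Borel sets `S ⊆ (0,1]`.  Hence a map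
into `Multisubset` is measurable (a random multisubset) iff all these counts are measurable. -/
noncomputable instance : MeasurableSpace Multisubset :=
  ⨆ S : {S : Set ℝ // MeasurableSet S ∧ S ⊆ Set.Ioc 0 1},
    MeasurableSpace.comap (fun A : Multisubset => A.count S.1) inferInstance

end Multisubset

/-- Given the function `N` with `N x` the number of elements that are `≥ x` of some collection of
nonnegative reals, the `i`-th largest element of the collection with `i` counted from `0`, i.e.
the largest `x > 0` such that at least `i + 1` elements are `≥ x`, and `0` if there is none.
(The supremum is attained whenever the collection is bounded and has only finitely many elements
above each positive level, in particular when its sum is finite.) -/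
noncomputable def rankOfTail (N : ℝ → ℝ≥0∞) (i : ℕ) : ℝ :=
  sSup {x : ℝ | 0 < x ∧ ((i : ℝ≥0∞) + 1) ≤ N x}

/-- The elements of a multisubset of `(0,1]`, with repetitions, in decreasing order, padded with
zeros. -/
noncomputable def Multisubset.ranked (A : Multisubset) : ℕ → ℝ :=
  rankOfTail (fun x => A.count (Set.Ici x))

/-- The positive terms of a sequence, with repetitions, in decreasing order, padded with zeros. -/
noncomputable def rankedSeq (g : ℕ → ℝ) : ℕ → ℝ :=
  rankOfTail (fun x => (({j : ℕ | x ≤ g j}.encard : ℕ∞) : ℝ≥0∞))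

/-- Stick breaking: `1 - v₀, v₀ (1 - v₁), v₀ v₁ (1 - v₂), …`. -/
noncomputable def stickBreaking (v : ℕ → ℝ) (i : ℕ) : ℝ :=
  (∏ j ∈ Finset.range i, v j) * (1 - v i)

/-- The law of a sequence of independent uniform random variables on the unit interval. -/
noncomputable def iidUniform : Measure (ℕ → unitInterval) :=
  Measure.infinitePi (fun _ : ℕ => (volume : Measure unitInterval))

instance : IsProbabilityMeasure iidUniform := by
  unfold iidUniform; infer_instance

/-- The GEM(`θ`) sequence as a random sequence on the probability space of a sequence `u` of
independent uniforms: stick breaking with `V i = (u i) ^ (1 / θ)`, for `θ > 0`. -/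
noncomputable def gemSeq (θ : ℝ) (u : ℕ → unitInterval) : ℕ → ℝ :=
  stickBreaking (fun i => (u i : ℝ) ^ (1 / θ))

/-- The Poisson–Dirichlet sequence PD(`θ`) as a random sequence under `iidUniform`, for `θ > 0`:
the GEM(`θ`) sequence ranked in decreasing order. -/
noncomputable def pdSeq (θ : ℝ) (u : ℕ → unitInterval) : ℕ → ℝ :=
  rankedSeq (gemSeq θ u)

/-- Finitely many pairwise disjoint closed intervals `[a i, b i] ⊆ (0,1]` with `∑ b i < 1`. -/
structure AdmissibleIntervals {k : ℕ} (a b : Fin k → ℝ) : Prop where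
  pos : ∀ i, 0 < a i
  lt : ∀ i, a i < b i
  le_one : ∀ i, b i ≤ 1
  disjoint : Pairwise fun i j => Disjoint (Set.Icc (a i) (b i)) (Set.Icc (a j) (b j))
  sum_lt : ∑ i, b i < 1

/-! ### Ranking through tail counts -/

section Rank

/-! By the portmanteau theorem it suffices to bound `liminf P(L(n) ∈ G)` below by the PD(1)-mass of
each open `G`. The bridge is size-biased picking: for a multiset of mass at most 1, the weights `x₁
· x₂/(1 - x₁) · x₃/(1 - x₁ - x₂) ⋯` sum to at most 1 over successive picks without replacement
(`sum_gemDensity_mul_prod_le_one`). Apart from the sizes `∏ xᵢ`, this weight is the joint density of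
the first GEM(1) terms.

Cut `(0,1]` into cells of length `1/N` and keep the boxes of `k` distinct cells such that meeting
all of them forces the ranked sequence into `G`. Over these boxes, the weights taken at left
endpoints, times the cell counts, sum to at most the indicator of `L(n) ∈ G`
(`sum_isGoodBox_le_indicator`). In the mean, (1) bounds the product of counts below by `∏ 1/(mᵢ +
1)`, which nearly cancels the sizes and leaves a Riemann sum of the GEM density over good boxes
(`lintegral_goodDensity_le_liminf`).

Let `N → ∞` and then `k → ∞`, by Fatou each time. Almost surely the first `k` GEM terms nearly
exhaust the mass 1, so a multiset with elements close to them has nearly the same ranking, and their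
box is good once the ranked GEM sequence lies in `G` (`ae_eventually_gemDensity_le`). Lower bounds
on the moments suffice because the picking weights never exceed total mass 1. -/

lemma rankOfTail_nonneg (N : ℝ → ℝ≥0∞) (i : ℕ) : 0 ≤ rankOfTail N i :=
  Real.sSup_nonneg fun _ hx => hx.1.le

lemma bddAbove_rankOfTail {N : ℝ → ℝ≥0∞} (hN : ∀ x, 1 < x → N x = 0) (i : ℕ) :
    BddAbove {x : ℝ | 0 < x ∧ ((i : ℝ≥0∞) + 1) ≤ N x} := by
  refine ⟨1, fun x hx => ?_⟩
  by_contra! h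
  have := hx.2
  rw [hN x h] at this
  simp at this

lemma rankOfTail_le_add {N N' : ℝ → ℝ≥0∞} {η : ℝ} (hη : 0 ≤ η)
    (hN' : ∀ x, 1 < x → N' x = 0) (h : ∀ y, 0 < y → N (y + η) ≤ N' y) (i : ℕ) :
    rankOfTail N i ≤ rankOfTail N' i + η := by
  refine Real.sSup_le (fun x hx => ?_) (add_nonneg (rankOfTail_nonneg _ _) hη)
  rcases le_or_gt x η with hxη | hxη
  · linarith [rankOfTail_nonneg N' i]
  · have : x - η ≤ rankOfTail N' i := by
      refine le_csSup (bddAbove_rankOfTail hN' i) ⟨by linarith, hx.2.trans ?_⟩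
      simpa using h (x - η) (by linarith)
    linarith

/-- Since tails are antitone, the supremum exceeds `c ≥ 0` exactly when some rational level above
`c` still has `i + 1` elements; this is a countable union. -/
lemma measurable_rankOfTail {Ω : Type*} [MeasurableSpace Ω] {N : Ω → ℝ → ℝ≥0∞}
    (hanti : ∀ ω, Antitone (N ω)) (hN : ∀ ω x, 1 < x → N ω x = 0)
    (hm : ∀ x, Measurable fun ω => N ω x) :
    Measurable fun ω => rankOfTail (N ω) := by
  refine measurable_pi_lambda _ fun i => measurable_of_Ioi fun c => ?_
  rcases lt_or_ge c 0 with hc | hc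
  · convert MeasurableSet.univ
    ext ω
    simpa using hc.trans_le (rankOfTail_nonneg _ _)
  · have : (fun ω => rankOfTail (N ω) i) ⁻¹' Set.Ioi c
        = ⋃ q : {q : ℚ // c < q}, {ω | (i : ℝ≥0∞) + 1 ≤ N ω q} := by
      ext ω
      simp only [Set.mem_preimage, Set.mem_Ioi, Set.mem_iUnion, Set.mem_ofPred_eq]
      constructor
      · intro h
        have hne : {x : ℝ | 0 < x ∧ ((i : ℝ≥0∞) + 1) ≤ N ω x}.Nonempty := by
          by_contra! hemp
          rw [rankOfTail, hemp, Real.sSup_empty] at h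
          linarith
        obtain ⟨x, hx, hcx⟩ := exists_lt_of_lt_csSup hne h
        obtain ⟨q, hq1, hq2⟩ := exists_rat_btwn hcx
        exact ⟨⟨q, hq1⟩, hx.2.trans (hanti ω hq2.le)⟩
      · rintro ⟨⟨q, hq⟩, h⟩
        exact hq.trans_le (le_csSup (bddAbove_rankOfTail (hN ω) i) ⟨hc.trans_lt hq, h⟩)
    rw [this]
    exact MeasurableSet.iUnion fun q => measurableSet_le measurable_const (hm _)

end Rank

/-! ### Counts and rankings of multisubsets -/

namespace Multisubset

lemma count_eq_tsum_indicator (A : Multisubset) (S : Set ℝ) :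
    A.count S = ∑' x : ℝ, S.indicator (fun x => (A.mult x : ℝ≥0∞)) x :=
  tsum_subtype S fun x => (A.mult x : ℝ≥0∞)

lemma mult_eq_zero (A : Multisubset) {x : ℝ} (hx : x ∉ Set.Ioc (0 : ℝ) 1) : A.mult x = 0 := by
  by_contra h
  exact hx (A.support_subset h)

lemma count_inter_Ioc (A : Multisubset) (S : Set ℝ) : A.count (S ∩ Set.Ioc 0 1) = A.count S := by
  simp only [count_eq_tsum_indicator]
  refine tsum_congr fun x => ?_
  by_cases hx : x ∈ Set.Ioc (0 : ℝ) 1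
  · by_cases hS : x ∈ S <;> simp [hS, hx.1, hx.2]
  · simp [Set.indicator, A.mult_eq_zero hx]

lemma count_mono (A : Multisubset) {S T : Set ℝ} (h : S ⊆ T) : A.count S ≤ A.count T := by
  simp only [count_eq_tsum_indicator]
  exact ENNReal.tsum_le_tsum fun x => Set.indicator_le_indicator_of_subset h (fun _ => zero_le) x

lemma measurable_count {S : Set ℝ} (hS : MeasurableSet S) :
    Measurable fun A : Multisubset => A.count S := by
  have : (fun A : Multisubset => A.count S) = fun A => A.count (S ∩ Set.Ioc 0 1) := by
    ext A
    rw [count_inter_Ioc]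
  rw [this, measurable_iff_comap_le]
  exact le_iSup (fun S : {S : Set ℝ // MeasurableSet S ∧ S ⊆ Set.Ioc 0 1} =>
    MeasurableSpace.comap (fun A : Multisubset => A.count S.1) inferInstance)
    ⟨S ∩ Set.Ioc 0 1, hS.inter measurableSet_Ioc, Set.inter_subset_right⟩

lemma exists_mem_of_count_ne_zero (A : Multisubset) {S : Set ℝ} (h : A.count S ≠ 0) :
    ∃ x ∈ S, A.mult x ≠ 0 := by
  by_contra! hcon
  refine h ?_
  rw [count, ENNReal.tsum_eq_zero]
  exact fun x => by simp [hcon x x.2]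

lemma count_eq_zero_or_one_le (A : Multisubset) (S : Set ℝ) : A.count S = 0 ∨ 1 ≤ A.count S := by
  by_cases h : A.count S = 0
  · exact Or.inl h
  · obtain ⟨x, hx, hm⟩ := A.exists_mem_of_count_ne_zero h
    refine Or.inr (le_trans ?_ (ENNReal.le_tsum (⟨x, hx⟩ : S)))
    exact_mod_cast Nat.one_le_iff_ne_zero.2 hm

lemma count_Ici_eq_zero (A : Multisubset) {x : ℝ} (hx : 1 < x) : A.count (Set.Ici x) = 0 := by
  by_contra h
  obtain ⟨y, hy, hm⟩ := A.exists_mem_of_count_ne_zero h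
  exact hm (A.mult_eq_zero fun h => by linarith [h.2, Set.mem_Ici.1 hy])

lemma measurable_ranked : Measurable fun A : Multisubset => A.ranked :=
  measurable_rankOfTail (fun A _ _ h => A.count_mono (Set.Ici_subset_Ici.2 h))
    (fun A _ hx => A.count_Ici_eq_zero hx) fun _ => measurable_count measurableSet_Ici

variable {k : ℕ} {a : Fin k → ℝ}

/-- One further copy of `z` on top of the `a i` would push the total mass above 1. -/
lemma mult_le_of_sum_lt (A : Multisubset) (hA : A.sum ≤ 1) (ha : Function.Injective a)
    (hm : ∀ i, A.mult (a i) ≠ 0) {z : ℝ} (hz : 1 < z + ∑ i, a i) (hz0 : 0 < z) :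
    A.mult z ≤ if z ∈ Finset.univ.image a then 1 else 0 := by
  classical
  by_contra! hlt
  set S := Finset.univ.image a with hS
  have hmS : ∀ x ∈ S, 1 ≤ A.mult x := by
    intro x hx
    obtain ⟨i, -, rfl⟩ := Finset.mem_image.1 hx
    exact Nat.one_le_iff_ne_zero.2 (hm i)
  have hapos : ∀ i, 0 < a i := fun i => (A.support_subset (hm i)).1
  have h1 : ∑ x ∈ insert z S, (A.mult x : ℝ≥0∞) * ENNReal.ofReal x ≤ 1 :=
    (ENNReal.sum_le_tsum _).trans hA
  have h2 : ∑ x ∈ insert z S, ((if x ∈ S then 1 else 0) + (if x = z then 1 else 0) : ℝ≥0∞)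
      * ENNReal.ofReal x ≤ ∑ x ∈ insert z S, (A.mult x : ℝ≥0∞) * ENNReal.ofReal x := by
    refine Finset.sum_le_sum fun x hx => mul_le_mul_left ?_ _
    have : (if x ∈ S then 1 else 0) + (if x = z then 1 else 0) ≤ A.mult x := by
      by_cases hxz : x = z
      · subst hxz
        simp only [if_true]
        omega
      · have hxS : x ∈ S := (Finset.mem_insert.1 hx).resolve_left hxz
        simpa [hxz, hxS] using hmS x hxS
    exact_mod_cast this
  have h3 : ∑ x ∈ insert z S, ((if x ∈ S then 1 else 0) + (if x = z then 1 else 0) : ℝ≥0∞)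
      * ENNReal.ofReal x = ENNReal.ofReal (∑ i, a i) + ENNReal.ofReal z := by
    simp only [add_mul, Finset.sum_add_distrib, ite_mul, one_mul, zero_mul]
    congr 1
    · rw [← Finset.sum_filter, Finset.filter_mem_eq_inter,
        Finset.inter_eq_right.2 (Finset.subset_insert _ _), hS,
        Finset.sum_image fun _ _ _ _ h => ha h,
        ENNReal.ofReal_sum_of_nonneg fun i _ => (hapos i).le]
    · simp
  rw [← ENNReal.ofReal_add (Finset.sum_nonneg fun i _ => (hapos i).le) hz0.le] at h3
  have h4 := h3.symm.le.trans (h2.trans h1)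
  rw [← ENNReal.ofReal_one, ENNReal.ofReal_le_ofReal_iff zero_le_one] at h4
  linarith

lemma tsum_indicator_image (ha : Function.Injective a) (t : ℝ) :
    ∑' x : ℝ, (Set.Ici t).indicator
      (fun x => ((if x ∈ Finset.univ.image a then 1 else 0 : ℕ) : ℝ≥0∞)) x
      = (Finset.univ.filter fun i => t ≤ a i).card := by
  classical
  rw [tsum_eq_sum (s := Finset.univ.image a)]
  · rw [Finset.sum_image fun _ _ _ _ h => ha h, Finset.card_filter]
    push_cast
    refine Finset.sum_congr rfl fun i _ => ?_
    simp [Set.indicator]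
  · intro x hx
    simp only [Set.indicator, hx, if_false, Nat.cast_zero, ite_self]

lemma count_Ici_le_card (A : Multisubset) (hA : A.sum ≤ 1) (ha : Function.Injective a)
    (hm : ∀ i, A.mult (a i) ≠ 0) {t : ℝ} (ht : 1 < t + ∑ i, a i) (ht0 : 0 < t) :
    A.count (Set.Ici t) ≤ (Finset.univ.filter fun i => t ≤ a i).card := by
  rw [← tsum_indicator_image ha, count_eq_tsum_indicator]
  refine ENNReal.tsum_le_tsum fun x => ?_
  by_cases hx : t ≤ x
  · simp only [Set.indicator, Set.mem_Ici, hx, if_true]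
    exact_mod_cast A.mult_le_of_sum_lt hA ha hm (by linarith) (ht0.trans_le hx)
  · simp [Set.indicator, hx]

lemma card_le_count_Ici (A : Multisubset) (ha : Function.Injective a)
    (hm : ∀ i, A.mult (a i) ≠ 0) (t : ℝ) :
    ((Finset.univ.filter fun i => t ≤ a i).card : ℝ≥0∞) ≤ A.count (Set.Ici t) := by
  rw [← tsum_indicator_image ha, count_eq_tsum_indicator]
  refine ENNReal.tsum_le_tsum fun x => Set.indicator_le_indicator ?_
  split_ifs with hx
  · obtain ⟨i, -, rfl⟩ := Finset.mem_image.1 hx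
    exact_mod_cast Nat.one_le_iff_ne_zero.2 (hm i)
  · simp

end Multisubset

/-! ### Ranked sequences and their distance to ranked multisubsets -/

section RankedSeq

variable {g : ℕ → ℝ}

lemma encard_eq_zero_of_one_lt (hg : ∀ i, g i ≤ 1) {x : ℝ} (hx : 1 < x) :
    (({j : ℕ | x ≤ g j}.encard : ℕ∞) : ℝ≥0∞) = 0 := by
  have : {j : ℕ | x ≤ g j} = ∅ := by
    ext j
    simpa using (hg j).trans_lt hx
  simp [this]

lemma encard_eq_tsum (S : Set ℕ) :
    ((S.encard : ℕ∞) : ℝ≥0∞) = ∑' j : ℕ, S.indicator (fun _ => (1 : ℝ≥0∞)) j := by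
  rw [← tsum_subtype, ENNReal.tsum_set_one]

lemma measurable_rankedSeq {Ω : Type*} [MeasurableSpace Ω] {g : Ω → ℕ → ℝ}
    (hg : Measurable g) (h1 : ∀ ω i, g ω i ≤ 1) : Measurable fun ω => rankedSeq (g ω) := by
  refine measurable_rankOfTail (fun ω x y hxy => ?_)
    (fun ω x hx => encard_eq_zero_of_one_lt (h1 ω) hx) fun x => ?_
  · simp only [ENat.toENNReal_le]
    exact Set.encard_le_encard fun j hj => hxy.trans hj
  · simp only [encard_eq_tsum]
    refine Measurable.tsum fun j => ?_
    have h : Measurable ({ω | x ≤ g ω j}.indicator fun _ => (1 : ℝ≥0∞)) :=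
      measurable_const.indicator
        (measurableSet_le measurable_const ((measurable_pi_apply j).comp hg))
    exact h

lemma encard_eq_card_filter {k : ℕ} {t : ℝ} (h : ∀ j, k ≤ j → g j < t) :
    (({j : ℕ | t ≤ g j}.encard : ℕ∞) : ℝ≥0∞)
      = (Finset.univ.filter fun i : Fin k => t ≤ g i).card := by
  have : {j : ℕ | t ≤ g j} = ((Finset.univ.filter fun i : Fin k => t ≤ g i).map Fin.valEmbedding :
      Finset ℕ) := by
    ext j
    simp only [Set.mem_ofPred_eq, Finset.coe_map, Finset.coe_filter, Finset.mem_univ, true_and,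
      Set.mem_image, Fin.valEmbedding_apply]
    constructor
    · intro hj
      have hjk : j < k := by
        by_contra! hcon
        exact absurd hj (not_le.2 (h j hcon))
      exact ⟨⟨j, hjk⟩, hj, rfl⟩
    · rintro ⟨i, hi, rfl⟩
      exact hi
  rw [this, Set.encard_coe_eq_coe_finsetCard, Finset.card_map]
  simp

lemma card_filter_le_encard (k : ℕ) (t : ℝ) :
    ((Finset.univ.filter fun i : Fin k => t ≤ g i).card : ℝ≥0∞)
      ≤ (({j : ℕ | t ≤ g j}.encard : ℕ∞) : ℝ≥0∞) := by
  have : (((Finset.univ.filter fun i : Fin k => t ≤ g i).map Fin.valEmbedding : Finset ℕ) :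
      Set ℕ) ⊆ {j : ℕ | t ≤ g j} := by
    intro j hj
    simp only [Finset.coe_map, Finset.coe_filter, Finset.mem_univ, true_and,
      Set.mem_image, Fin.valEmbedding_apply] at hj
    obtain ⟨i, hi, rfl⟩ := hj
    exact hi
  have h := Set.encard_le_encard this
  rw [Set.encard_coe_eq_coe_finsetCard, Finset.card_map] at h
  calc _ = (((Finset.univ.filter fun i : Fin k => t ≤ g i).card : ℕ∞) : ℝ≥0∞) := by simp
    _ ≤ _ := ENat.toENNReal_le.2 h

/-- If all but `k` elements of a multisubset and of a sequence are small, and the remaining elements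
are close, then the decreasing rearrangements are close. -/
lemma abs_ranked_sub_rankedSeq_le (A : Multisubset) (hA : A.sum ≤ 1) {k : ℕ} {a : Fin k → ℝ}
    (ha : Function.Injective a) (hm : ∀ i, A.mult (a i) ≠ 0) (hg1 : ∀ i, g i ≤ 1) {η : ℝ}
    (hη : 0 ≤ η) (haη : 1 ≤ η + ∑ i, a i) (hgη : ∀ j, k ≤ j → g j ≤ η)
    (hag : ∀ i : Fin k, |a i - g i| ≤ η) (i : ℕ) :
    |A.ranked i - rankedSeq g i| ≤ η := by
  rw [abs_sub_le_iff]
  constructor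
  · rw [sub_le_iff_le_add']
    refine (rankOfTail_le_add hη (fun x hx => encard_eq_zero_of_one_lt hg1 hx) (fun y hy => ?_) i)
    refine (A.count_Ici_le_card hA ha hm (by linarith) (by linarith)).trans ?_
    refine le_trans ?_ (card_filter_le_encard k y)
    refine Nat.cast_le.2 (Finset.card_le_card fun i hi => ?_)
    simp only [Finset.mem_filter, Finset.mem_univ, true_and] at hi ⊢
    linarith [(abs_le.1 (hag i)).2]
  · rw [sub_le_iff_le_add']
    refine (rankOfTail_le_add hη (fun x hx => A.count_Ici_eq_zero hx) (fun y hy => ?_) i)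
    rw [encard_eq_card_filter (k := k) fun j hj => by linarith [hgη j hj]]
    refine le_trans ?_ (A.card_le_count_Ici ha hm y)
    refine Nat.cast_le.2 (Finset.card_le_card fun i hi => ?_)
    simp only [Finset.mem_filter, Finset.mem_univ, true_and] at hi ⊢
    linarith [(abs_le.1 (hag i)).1]

end RankedSeq

/-! ### The GEM density and size-biased picks -/

section GemDensity

/-- The joint density on the simplex of the first `k` terms of the GEM(1) sequence. -/
noncomputable def gemDensity {k : ℕ} (x : Fin k → ℝ) : ℝ≥0∞ :=
  ∏ i, ENNReal.ofReal (1 - ∑ j, if j < i then x j else 0)⁻¹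

lemma gemDensity_snoc {k : ℕ} (x : Fin k → ℝ) (y : ℝ) :
    gemDensity (Fin.snoc x y : Fin (k + 1) → ℝ)
      = gemDensity x * ENNReal.ofReal (1 - ∑ i, x i)⁻¹ := by
  rw [gemDensity, Fin.prod_univ_castSucc, gemDensity]
  congr 1
  · refine Finset.prod_congr rfl fun i _ => ?_
    rw [Fin.sum_univ_castSucc]
    simp [not_lt.2 (Fin.castSucc_lt_last i).le]
  · rw [Fin.sum_univ_castSucc]
    simp [Fin.castSucc_lt_last]

lemma measurable_gemDensity {k : ℕ} : Measurable (gemDensity : (Fin k → ℝ) → ℝ≥0∞) := by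
  unfold gemDensity
  refine Finset.measurable_fun_prod _ fun i _ => ?_
  refine (measurable_const.sub (Finset.measurable_fun_sum _ fun j _ => ?_)).inv.ennreal_ofReal
  split_ifs <;> fun_prop

lemma gemDensity_ne_top {k : ℕ} (x : Fin k → ℝ) : gemDensity x ≠ ∞ :=
  ENNReal.prod_ne_top fun _ _ => ENNReal.ofReal_ne_top

lemma sum_ite_lt_one {k : ℕ} {x : Fin k → ℝ} (hx : ∀ i, 0 ≤ x i) (h1 : ∑ i, x i < 1) (i : Fin k) :
    ∑ j, (if j < i then x j else 0) < 1 := by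
  refine lt_of_le_of_lt (Finset.sum_le_sum fun j _ => ?_) h1
  split_ifs
  exacts [le_rfl, hx j]

lemma gemDensity_ne_zero {k : ℕ} {x : Fin k → ℝ} (hx : ∀ i, 0 ≤ x i) (h1 : ∑ i, x i < 1) :
    gemDensity x ≠ 0 := by
  refine Finset.prod_ne_zero_iff.2 fun i _ => ?_
  rw [ne_eq, ENNReal.ofReal_eq_zero, not_le]
  exact inv_pos.2 (by linarith [sum_ite_lt_one hx h1 i])

lemma continuousAt_gemDensity {k : ℕ} {x : Fin k → ℝ} (hx : ∀ i, 0 ≤ x i) (h1 : ∑ i, x i < 1) :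
    ContinuousAt gemDensity x := by
  unfold gemDensity
  refine ENNReal.tendsto_finsetProd_of_ne_top _ (fun i _ => ?_) fun _ _ => ENNReal.ofReal_ne_top
  refine (ENNReal.continuous_ofReal.tendsto _).comp (Tendsto.inv₀ ?_ ?_)
  · refine Continuous.tendsto (continuous_const.sub (continuous_finsetSum _ fun j _ => ?_)) x
    split_ifs <;> fun_prop
  · linarith [sum_ite_lt_one hx h1 i]

open Classical in
/-- Summed over distinct `j 0, …, j (k - 1)`, the weights of successive size-biased picks without
replacement from a collection of total mass at most `1` are at most `1`; here `c i` is the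
multiplicity of the mass `p i`. -/
lemma sum_gemDensity_mul_prod_le_one {ι : Type*} [Fintype ι] {p : ι → ℝ} (hp : ∀ i, 0 ≤ p i)
    {c : ι → ℝ≥0∞} (hc : ∀ i, c i = 0 ∨ 1 ≤ c i) (h : ∑ i, ENNReal.ofReal (p i) * c i ≤ 1)
    (k : ℕ) :
    ∑ j : Fin k → ι, (if Function.Injective j then
      gemDensity (p ∘ j) * ∏ i, ENNReal.ofReal (p (j i)) * c (j i) else 0) ≤ 1 := by
  induction k with
  | zero => simp [gemDensity, Function.injective_of_subsingleton]
  | succ k ih =>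
    refine le_trans ?_ ih
    rw [← (Fin.snocEquiv fun _ => ι).sum_comp, Fintype.sum_prod_type_right]
    refine Finset.sum_le_sum fun j _ => ?_
    by_cases hj : Function.Injective j
    swap
    · refine le_of_eq_of_le (Finset.sum_eq_zero fun y _ => if_neg fun hinj => hj ?_) zero_le
      intro a b hab
      have := @hinj a.castSucc b.castSucc (by simpa [Fin.snocEquiv] using hab)
      exact Fin.castSucc_injective _ this
    rw [if_pos hj]
    -- Picking an index removes mass `p (j i)` from a total counted with weights `c`; this needs `c
    -- (j i) ≥ 1`, and picks with `c (j i) = 0` contribute nothing.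
    by_cases hcj : ∀ i, 1 ≤ c (j i)
    swap
    · push Not at hcj
      obtain ⟨i, hi⟩ := hcj
      have hi0 : c (j i) = 0 := (hc _).resolve_right (not_le.2 hi)
      refine le_of_eq_of_le (Finset.sum_eq_zero fun y _ => ?_) zero_le
      split_ifs
      · refine mul_eq_zero_of_right _ (Finset.prod_eq_zero (Finset.mem_univ i.castSucc) ?_)
        simp [Fin.snocEquiv, hi0]
      · rfl
    have hle : ∀ y : ι, (if Function.Injective (Fin.snocEquiv (fun _ => ι) (y, j)) then
        gemDensity (p ∘ (Fin.snocEquiv (fun _ => ι) (y, j)))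
          * ∏ i, ENNReal.ofReal (p (Fin.snocEquiv (fun _ => ι) (y, j) i))
            * c (Fin.snocEquiv (fun _ => ι) (y, j) i) else 0)
        ≤ (gemDensity (p ∘ j) * ∏ i, ENNReal.ofReal (p (j i)) * c (j i)) *
          (ENNReal.ofReal (1 - ∑ i, p (j i))⁻¹ *
            if y ∈ Finset.univ.image j then 0 else ENNReal.ofReal (p y) * c y) := by
      intro y
      split_ifs with hinj hy hy
      · obtain ⟨i, -, hi⟩ := Finset.mem_image.1 hy
        have := @hinj i.castSucc (Fin.last k) (by simpa [Fin.snocEquiv] using hi)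
        exact absurd this (Fin.castSucc_lt_last i).ne
      · have hcomp : p ∘ (Fin.snocEquiv (fun _ => ι) (y, j))
            = (Fin.snoc (p ∘ j) (p y) : Fin (k + 1) → ℝ) := by
          rw [← Fin.comp_snoc]
          rfl
        rw [hcomp, gemDensity_snoc, Fin.prod_univ_castSucc]
        simp only [Fin.snocEquiv, Equiv.coe_fn_mk, Fin.snoc_castSucc, Fin.snoc_last,
          Function.comp_apply]
        refine le_of_eq ?_
        ring
      · exact zero_le
      · exact zero_le
    refine (Finset.sum_le_sum fun y _ => hle y).trans ?_
    rw [← Finset.mul_sum]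
    refine mul_le_of_le_one_right' ?_
    rw [← Finset.mul_sum]
    have hsplit : (∑ y, if y ∈ Finset.univ.image j then 0 else ENNReal.ofReal (p y) * c y)
        + ENNReal.ofReal (∑ i, p (j i)) ≤ 1 := by
      refine le_trans ?_ h
      have : ENNReal.ofReal (∑ i, p (j i))
          ≤ ∑ y, if y ∈ Finset.univ.image j then ENNReal.ofReal (p y) * c y else 0 := by
        rw [← Finset.sum_filter, Finset.filter_mem_eq_inter, Finset.univ_inter,
          Finset.sum_image fun _ _ _ _ h => hj h, ENNReal.ofReal_sum_of_nonneg fun i _ => hp _]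
        exact Finset.sum_le_sum fun i _ => le_mul_of_one_le_right' (hcj i)
      refine (add_le_add_right this _).trans_eq ?_
      rw [← Finset.sum_add_distrib]
      refine Finset.sum_congr rfl fun y _ => ?_
      split_ifs <;> simp
    have hle1 : (∑ y, if y ∈ Finset.univ.image j then 0 else ENNReal.ofReal (p y) * c y)
        ≤ ENNReal.ofReal (1 - ∑ i, p (j i)) := by
      rw [ENNReal.ofReal_sub _ (Finset.sum_nonneg fun i _ => hp _), ENNReal.ofReal_one]
      exact ENNReal.le_sub_of_add_le_right ENNReal.ofReal_ne_top hsplit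
    refine (mul_le_mul_right hle1 _).trans ?_
    -- If the picks already exhaust the mass, the bound on what remains is zero, whatever the value
    -- of the inverse.
    rcases le_or_gt (1 - ∑ i, p (j i)) 0 with h0 | h0
    · simp [ENNReal.ofReal_eq_zero.2 h0]
    · rw [← ENNReal.ofReal_mul (inv_pos.2 h0).le, inv_mul_cancel₀ h0.ne', ENNReal.ofReal_one]

end GemDensity

/-! ### Stick breaking with uniform variables -/

section GemSeq

open scoped unitInterval

lemma gemSeq_one_apply (u : ℕ → I) (i : ℕ) :
    gemSeq 1 u i = (∏ j ∈ Finset.range i, (u j : ℝ)) * (1 - u i) := by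
  simp [gemSeq, stickBreaking]

lemma measurable_gemSeq_one : Measurable (gemSeq 1) := by
  refine measurable_pi_lambda _ fun i => ?_
  simp only [gemSeq_one_apply]
  fun_prop

lemma prod_range_nonneg (u : ℕ → I) (k : ℕ) : 0 ≤ ∏ j ∈ Finset.range k, (u j : ℝ) :=
  Finset.prod_nonneg fun j _ => (u j).2.1

lemma sum_range_gemSeq_one (u : ℕ → I) (k : ℕ) :
    ∑ i ∈ Finset.range k, gemSeq 1 u i = 1 - ∏ j ∈ Finset.range k, (u j : ℝ) := by
  induction k with
  | zero => simp
  | succ k ih =>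
    rw [Finset.sum_range_succ, ih, gemSeq_one_apply, Finset.prod_range_succ]
    ring

lemma gemSeq_one_le_prod (u : ℕ → I) {k i : ℕ} (h : k ≤ i) :
    gemSeq 1 u i ≤ ∏ j ∈ Finset.range k, (u j : ℝ) := by
  rw [gemSeq_one_apply]
  refine (mul_le_of_le_one_right (prod_range_nonneg u i) (by linarith [(u i).2.1])).trans ?_
  exact Finset.prod_le_prod_of_subset_of_le_one (Finset.range_mono h) (fun j _ => (u j).2.1)
    fun j _ _ => (u j).2.2

lemma gemSeq_one_le_one (u : ℕ → I) (i : ℕ) : gemSeq 1 u i ≤ 1 := by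
  simpa using gemSeq_one_le_prod u (Nat.zero_le i)

lemma measurable_pdSeq_one : Measurable (pdSeq 1) :=
  measurable_rankedSeq measurable_gemSeq_one gemSeq_one_le_one

/-- Resampling one coordinate does not change the law of an i.i.d. uniform sequence. -/
lemma map_update_iidUniform (k : ℕ) :
    (iidUniform.prod (volume : Measure I)).map
      (fun z : (ℕ → I) × I => Function.update z.1 k z.2) = iidUniform := by
  refine Measure.eq_infinitePi (μ := fun _ : ℕ => (volume : Measure I)) fun s t ht => ?_
  have hm : Measurable fun z : (ℕ → I) × I => Function.update z.1 k z.2 :=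
    measurable_update'
  rw [Measure.map_apply hm (MeasurableSet.pi s.countable_toSet fun i _ => ht i)]
  have hpre : (fun z : (ℕ → I) × I => Function.update z.1 k z.2) ⁻¹' (Set.pi s t)
      = (Set.pi (s.erase k : Finset ℕ) t) ×ˢ (if k ∈ s then t k else Set.univ) := by
    ext ⟨u, v⟩
    simp only [Set.mem_preimage, Set.mem_pi, Set.mem_prod, Finset.mem_coe, Finset.mem_erase]
    constructor
    · intro h
      refine ⟨fun i hi => by simpa [Function.update_of_ne hi.1] using h i hi.2, ?_⟩
      split_ifs with hk
      · simpa using h k hk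
      · trivial
    · rintro ⟨h1, h2⟩ i hi
      by_cases hik : i = k
      · subst hik
        simpa [hi] using h2
      · simpa [Function.update_of_ne hik] using h1 i ⟨hik, hi⟩
  rw [hpre, Measure.prod_prod, iidUniform, Measure.infinitePi_pi _ fun i _ => ht i]
  split_ifs with hk
  · rw [mul_comm, Finset.mul_prod_erase s (fun i => volume (t i)) hk]
  · rw [Finset.erase_eq_of_notMem hk, measure_univ, mul_one]

lemma lintegral_iidUniform_update (k : ℕ) {F : (ℕ → I) → ℝ≥0∞} (hF : Measurable F) :
    ∫⁻ u, F u ∂iidUniform = ∫⁻ u, (∫⁻ t : I, F (Function.update u k t)) ∂iidUniform := by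
  have hm : Measurable fun z : (ℕ → I) × I => Function.update z.1 k z.2 :=
    measurable_update'
  conv_lhs => rw [← map_update_iidUniform k]
  rw [lintegral_map hF hm, lintegral_prod (fun z : (ℕ → I) × I =>
    F (Function.update z.1 k z.2)) (hF.comp hm).aemeasurable]

/-- The integral over `(0, s)` is enlarged to the whole line, since only an upper bound is needed.
-/
lemma lintegral_unitInterval_comp_le {s : ℝ} (hs : 0 < s) {φ : ℝ → ℝ≥0∞} (hφ : Measurable φ) :
    ∫⁻ t : I, φ (s * (1 - t)) ≤ ENNReal.ofReal s⁻¹ * ∫⁻ y, φ y := by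
  calc ∫⁻ t : I, φ (s * (1 - t)) = ∫⁻ t in Set.Icc (0 : ℝ) 1, φ (s * (1 - t)) :=
        lintegral_subtype_comap measurableSet_Icc fun t => φ (s * (1 - t))
    _ ≤ ∫⁻ t, φ (s * (1 - t)) := setLIntegral_le_lintegral _ _
    _ = ∫⁻ t, φ (s * t) := lintegral_sub_left_eq_self (fun t => φ (s * t)) 1
    _ = ∫⁻ y, φ y ∂(Measure.map (s * ·) volume) :=
        (lintegral_map hφ (measurable_const_mul s)).symm
    _ = ENNReal.ofReal s⁻¹ * ∫⁻ y, φ y := by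
        rw [Real.map_volume_mul_left hs.ne', lintegral_smul_measure, abs_of_pos (inv_pos.2 hs),
          smul_eq_mul]

lemma ae_iidUniform_mem_Ioo : ∀ᵐ u ∂iidUniform, ∀ i, (u i : ℝ) ∈ Set.Ioo (0 : ℝ) 1 := by
  refine ae_all_iff.2 fun i => ?_
  have h : ∀ᵐ t : I, t ≠ 0 ∧ t ≠ 1 :=
    (Measure.ae_ne volume 0).and (Measure.ae_ne volume 1)
  have hmp := measurePreserving_eval_infinitePi (fun _ : ℕ => (volume : Measure I)) i
  filter_upwards [hmp.quasiMeasurePreserving.ae h] with u hu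
  exact ⟨unitInterval.pos_iff_ne_zero.2 hu.1, unitInterval.lt_one_iff_ne_one.2 hu.2⟩

lemma lintegral_unitInterval_ofReal : ∫⁻ t : I, ENNReal.ofReal t = ENNReal.ofReal (1 / 2) := by
  calc ∫⁻ t : I, ENNReal.ofReal t = ∫⁻ t in Set.Icc (0 : ℝ) 1, ENNReal.ofReal t :=
        lintegral_subtype_comap measurableSet_Icc fun t => ENNReal.ofReal t
    _ = ENNReal.ofReal (∫ t in Set.Icc (0 : ℝ) 1, t) := by
        refine (ofReal_integral_eq_lintegral_ofReal ?_ ?_).symm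
        · exact continuous_id.integrableOn_Icc
        · exact (ae_restrict_iff' measurableSet_Icc).2 (Eventually.of_forall fun t ht => ht.1)
    _ = ENNReal.ofReal (1 / 2) := by
        rw [integral_Icc_eq_integral_Ioc, ← intervalIntegral.integral_of_le zero_le_one,
          integral_id]
        norm_num

lemma prod_range_update (u : ℕ → I) (k : ℕ) (t : I) :
    ∏ j ∈ Finset.range k, (Function.update u k t j : ℝ) = ∏ j ∈ Finset.range k, (u j : ℝ) := by
  refine Finset.prod_congr rfl fun j hj => ?_
  rw [Function.update_of_ne (Finset.mem_range.1 hj).ne]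

lemma measurable_ofReal_prod_range (k : ℕ) :
    Measurable fun u : ℕ → I => ENNReal.ofReal (∏ j ∈ Finset.range k, (u j : ℝ)) :=
  (Finset.measurable_fun_prod _ fun j _ =>
    measurable_subtype_coe.comp (measurable_pi_apply j)).ennreal_ofReal

lemma lintegral_prod_range (k : ℕ) :
    ∫⁻ u, ENNReal.ofReal (∏ j ∈ Finset.range k, (u j : ℝ)) ∂iidUniform
      = ENNReal.ofReal (1 / 2) ^ k := by
  induction k with
  | zero => simp
  | succ k ih =>
    rw [lintegral_iidUniform_update k (measurable_ofReal_prod_range (k + 1)), pow_succ, ← ih,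
      ← lintegral_mul_const _ (measurable_ofReal_prod_range k)]
    refine lintegral_congr fun u => ?_
    rw [← lintegral_unitInterval_ofReal,
      ← lintegral_const_mul _ measurable_subtype_coe.ennreal_ofReal]
    refine lintegral_congr fun t => ?_
    rw [Finset.prod_range_succ, prod_range_update, Function.update_self,
      ENNReal.ofReal_mul (prod_range_nonneg u k)]

/-- The remaining stick has mean `2⁻ᵏ`, which is summable, so the series of remainders is almost
surely finite. -/
lemma ae_tendsto_prod_range :
    ∀ᵐ u ∂iidUniform, Tendsto (fun k => ∏ j ∈ Finset.range k, (u j : ℝ)) atTop (nhds 0) := by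
  have hsum : ∫⁻ u, ∑' k, ENNReal.ofReal (∏ j ∈ Finset.range k, (u j : ℝ)) ∂iidUniform ≠ ∞ := by
    rw [lintegral_tsum fun k => (measurable_ofReal_prod_range k).aemeasurable]
    simp only [lintegral_prod_range, ENNReal.tsum_geometric]
    refine ENNReal.inv_ne_top.2 (tsub_pos_of_lt ?_).ne'
    rw [← ENNReal.ofReal_one]
    exact (ENNReal.ofReal_lt_ofReal_iff one_pos).2 (by norm_num)
  have hm : Measurable fun u : ℕ → I =>
      ∑' k, ENNReal.ofReal (∏ j ∈ Finset.range k, (u j : ℝ)) :=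
    Measurable.tsum measurable_ofReal_prod_range
  filter_upwards [ae_lt_top hm hsum] with u hu
  have h := (ENNReal.tendsto_toReal ENNReal.zero_ne_top).comp
    (ENNReal.tendsto_atTop_zero_of_tsum_ne_top hu.ne)
  refine h.congr fun k => ?_
  exact ENNReal.toReal_ofReal (prod_range_nonneg u k)

lemma lintegral_fin_succ {k : ℕ} {F : (Fin (k + 1) → ℝ) → ℝ≥0∞} (hF : Measurable F) :
    ∫⁻ z, F z = ∫⁻ x : Fin k → ℝ, ∫⁻ y : ℝ, F (Fin.snoc x y : Fin (k + 1) → ℝ) := by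
  have hmp := (volume_preserving_piFinSuccAbove (fun _ : Fin (k + 1) => ℝ) (Fin.last k)).symm
  rw [← hmp.lintegral_comp hF, Measure.volume_eq_prod,
    lintegral_prod_symm' (fun z => F ((MeasurableEquiv.piFinSuccAbove (fun _ => ℝ)
      (Fin.last k)).symm z)) (hF.comp hmp.measurable)]
  refine lintegral_congr fun x => lintegral_congr fun y => ?_
  congr 1
  exact Fin.insertNth_last' y x

lemma measurable_snoc {k : ℕ} :
    Measurable fun z : (Fin k → ℝ) × ℝ => (Fin.snoc z.1 z.2 : Fin (k + 1) → ℝ) := by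
  refine measurable_pi_lambda _ fun i => ?_
  refine Fin.lastCases ?_ (fun i => ?_) i
  · simpa using measurable_snd
  · simp only [Fin.snoc_castSucc]
    exact (measurable_pi_apply i).comp measurable_fst

/-- Given the first `k` terms, resampling `u k` makes the next term uniform on `(0, s)`, with `s`
the remaining stick. This contributes the density factor `1 / s`. -/
lemma lintegral_gemSeq_le (k : ℕ) {f : (Fin k → ℝ) → ℝ≥0∞} (hf : Measurable f) :
    ∫⁻ u, f (fun i => gemSeq 1 u i) ∂iidUniform ≤ ∫⁻ x, gemDensity x * f x := by
  induction k with
  | zero =>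
    have h : ∀ x : Fin 0 → ℝ, f x = f default := fun x => by rw [Subsingleton.elim x default]
    simp only [h, gemDensity, Finset.univ_eq_empty, Finset.prod_empty, one_mul, lintegral_const,
      measure_univ, mul_one]
    simp [volume_pi]
  | succ k ih =>
    have hrestr : ∀ n, Measurable fun u : ℕ → I => fun i : Fin n => gemSeq 1 u i := fun n =>
      measurable_pi_lambda _ fun i => (measurable_pi_apply (i : ℕ)).comp measurable_gemSeq_one
    have hsnoc : ∀ (u : ℕ → I) (t : I), (fun i : Fin (k + 1) => gemSeq 1 (Function.update u k t) i)
        = (Fin.snoc (fun i : Fin k => gemSeq 1 u i)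
            ((1 - ∑ i : Fin k, gemSeq 1 u i) * (1 - t)) : Fin (k + 1) → ℝ) := by
      intro u t
      ext i
      refine Fin.lastCases ?_ (fun i => ?_) i
      · rw [Fin.snoc_last, Fin.val_last, gemSeq_one_apply, prod_range_update, Function.update_self,
          ← Finset.sum_range (fun i => gemSeq 1 u i), sum_range_gemSeq_one]
        ring
      · rw [Fin.snoc_castSucc, Fin.val_castSucc, gemSeq_one_apply, gemSeq_one_apply,
          Function.update_of_ne i.2.ne]
        congr 1
        refine Finset.prod_congr rfl fun j hj => ?_
        rw [Function.update_of_ne ((Finset.mem_range.1 hj).trans i.2).ne]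
    have hfx : ∀ x : Fin k → ℝ, Measurable fun y : ℝ => f (Fin.snoc x y : Fin (k + 1) → ℝ) :=
      fun x => hf.comp (measurable_snoc.comp (measurable_prodMk_left (x := x)))
    have hG : Measurable fun x : Fin k → ℝ =>
        ENNReal.ofReal (1 - ∑ i, x i)⁻¹ * ∫⁻ y : ℝ, f (Fin.snoc x y : Fin (k + 1) → ℝ) := by
      refine Measurable.mul (by fun_prop) ?_
      exact Measurable.lintegral_prod_right' (f := fun z : (Fin k → ℝ) × ℝ =>
        f (Fin.snoc z.1 z.2 : Fin (k + 1) → ℝ)) (hf.comp measurable_snoc)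
    rw [lintegral_iidUniform_update k (F := fun u => f fun i => gemSeq 1 u i) (hf.comp (hrestr _))]
    calc ∫⁻ u, (∫⁻ t : I, f (fun i => gemSeq 1 (Function.update u k t) i)) ∂iidUniform
        ≤ ∫⁻ u, (fun x : Fin k → ℝ => ENNReal.ofReal (1 - ∑ i, x i)⁻¹
            * ∫⁻ y : ℝ, f (Fin.snoc x y : Fin (k + 1) → ℝ)) (fun i => gemSeq 1 u i)
            ∂iidUniform := by
          refine lintegral_mono_ae ?_
          filter_upwards [ae_iidUniform_mem_Ioo] with u hu
          simp only [hsnoc]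
          have hpos : 0 < 1 - ∑ i : Fin k, gemSeq 1 u i := by
            rw [← Finset.sum_range (fun i => gemSeq 1 u i), sum_range_gemSeq_one, sub_sub_cancel]
            exact Finset.prod_pos fun j _ => (hu j).1
          exact lintegral_unitInterval_comp_le hpos (φ := fun y =>
            f (Fin.snoc (fun i : Fin k => gemSeq 1 u i) y : Fin (k + 1) → ℝ))
            (hfx _)
      _ ≤ ∫⁻ x : Fin k → ℝ, gemDensity x * (ENNReal.ofReal (1 - ∑ i, x i)⁻¹
            * ∫⁻ y : ℝ, f (Fin.snoc x y : Fin (k + 1) → ℝ)) := ih hG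
      _ = ∫⁻ x, gemDensity x * f x := by
          rw [lintegral_fin_succ (F := fun x => gemDensity x * f x) (measurable_gemDensity.mul hf)]
          refine lintegral_congr fun x => ?_
          simp only [gemDensity_snoc]
          rw [lintegral_const_mul _ (hfx x), mul_assoc]

lemma ae_injective_volume (k : ℕ) : ∀ᵐ x : Fin k → ℝ, Function.Injective x := by
  have h : ∀ i j : Fin k, i ≠ j → ∀ᵐ x : Fin k → ℝ, x i ≠ x j := by
    intro i j hij
    let L : (Fin k → ℝ) →ₗ[ℝ] ℝ :=
      LinearMap.proj (R := ℝ) (φ := fun _ => ℝ) i - LinearMap.proj (R := ℝ) (φ := fun _ => ℝ) j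
    have hL : LinearMap.ker L ≠ ⊤ := by
      intro htop
      have : (Pi.single i 1 : Fin k → ℝ) ∈ LinearMap.ker L := htop ▸ Submodule.mem_top
      simp [L, hij.symm] at this
    have h0 := Measure.addHaar_submodule (volume : Measure (Fin k → ℝ)) _ hL
    filter_upwards [measure_eq_zero_iff_ae_notMem.1 h0] with x hx hxij
    exact hx (by simp [L, hxij])
  have : ∀ᵐ x : Fin k → ℝ, ∀ i j : Fin k, i ≠ j → x i ≠ x j :=
    ae_all_iff.2 fun i => ae_all_iff.2 fun j => by
      by_cases hij : i = j
      · simp [hij]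
      · filter_upwards [h i j hij] with x hx _ using hx
  filter_upwards [this] with x hx i j hij
  by_contra hne
  exact hx i j hne hij

/-- The bound `lintegral_gemSeq_le` makes each prefix absolutely continuous, and vectors with a
repeated coordinate are Lebesgue-null. -/
lemma ae_injective_gemSeq : ∀ᵐ u ∂iidUniform, Function.Injective (gemSeq 1 u) := by
  have h : ∀ k, ∀ᵐ u ∂iidUniform, Function.Injective fun i : Fin k => gemSeq 1 u i := by
    intro k
    obtain ⟨t, hsub, htm, ht0⟩ :=
      exists_measurable_superset_of_null (ae_iff.1 (ae_injective_volume k))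
    have hle := lintegral_gemSeq_le k (f := t.indicator 1) (measurable_one.indicator htm)
    have hz : ∫⁻ x, gemDensity x * t.indicator 1 x = 0 := by
      refine (lintegral_eq_zero_iff
        (measurable_gemDensity.mul (measurable_one.indicator htm))).2 ?_
      filter_upwards [measure_eq_zero_iff_ae_notMem.1 ht0] with x hx
      simp [hx]
    have hz' := le_antisymm (hle.trans_eq hz) zero_le
    have hrestr : Measurable fun u : ℕ → I => fun i : Fin k => gemSeq 1 u i :=
      measurable_pi_lambda _ fun i => (measurable_pi_apply (i : ℕ)).comp measurable_gemSeq_one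
    filter_upwards [(lintegral_eq_zero_iff ((measurable_one.indicator htm).comp hrestr)).1 hz']
      with u hu
    by_contra hcon
    have hmem : (fun i : Fin k => gemSeq 1 u i) ∈ t := hsub hcon
    simp [hmem] at hu
  filter_upwards [ae_all_iff.2 h] with u hu i j hij
  have := @hu (max i j + 1) ⟨i, by omega⟩ ⟨j, by omega⟩ hij
  simpa using this

end GemSeq

/-! ### The grid of mesh `1 / N` -/

section Grid

/-- The `m`-th cell of the partition of `(0, ∞)` into half-open intervals of length `1 / N`. -/
def gridCell (N m : ℕ) : Set ℝ := Set.Ioc ((m : ℝ) / N) (((m : ℝ) + 1) / N)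

lemma measurableSet_gridCell (N m : ℕ) : MeasurableSet (gridCell N m) := measurableSet_Ioc

lemma eq_of_mem_gridCell {N m m' : ℕ} {x : ℝ} (h : x ∈ gridCell N m) (h' : x ∈ gridCell N m') :
    m = m' := by
  rcases N.eq_zero_or_pos with rfl | hN
  · simp [gridCell] at h
  have hN' : (0 : ℝ) < N := by exact_mod_cast hN
  have h1 : (m : ℝ) < m' + 1 := (div_lt_div_iff_of_pos_right hN').1 (h.1.trans_le h'.2)
  have h2 : (m' : ℝ) < m + 1 := (div_lt_div_iff_of_pos_right hN').1 (h'.1.trans_le h.2)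
  have h1' : m < m' + 1 := by exact_mod_cast h1
  have h2' : m' < m + 1 := by exact_mod_cast h2
  omega

lemma abs_sub_le_of_mem_gridCell {N m : ℕ} {x y : ℝ} (hx : x ∈ gridCell N m)
    (hy : y ∈ gridCell N m) : |x - y| ≤ 1 / N := by
  have h : ((m : ℝ) + 1) / N = (m : ℝ) / N + 1 / N := add_div _ _ _
  have h1 := hx.1
  have h2 := hx.2
  have h3 := hy.1
  have h4 := hy.2
  rw [abs_sub_le_iff]
  constructor <;> linarith

lemma mem_gridCell_ceil {N : ℕ} (hN : 0 < N) {x : ℝ} (hx : 0 < x) :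
    x ∈ gridCell N (⌈N * x⌉₊ - 1) := by
  have hN' : (0 : ℝ) < N := by exact_mod_cast hN
  have hpos : 0 < ⌈(N : ℝ) * x⌉₊ := Nat.ceil_pos.2 (by positivity)
  have hcast : ((⌈(N : ℝ) * x⌉₊ - 1 : ℕ) : ℝ) = ⌈(N : ℝ) * x⌉₊ - 1 := by
    rw [Nat.cast_sub hpos, Nat.cast_one]
  constructor
  · rw [hcast, div_lt_iff₀ hN']
    have := Nat.ceil_lt_add_one (show 0 ≤ (N : ℝ) * x by positivity)
    linarith
  · rw [hcast, le_div_iff₀ hN', sub_add_cancel, mul_comm]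
    exact Nat.le_ceil _

lemma ceil_sub_one_lt {N : ℕ} (hN : 0 < N) {x : ℝ} (hx1 : x ≤ 1) : ⌈N * x⌉₊ - 1 < N := by
  have : ⌈(N : ℝ) * x⌉₊ ≤ N := Nat.ceil_le.2 (mul_le_of_le_one_right (Nat.cast_nonneg N) hx1)
  omega

lemma tendsto_ceil_sub_one_div {x : ℝ} (hx : 0 < x) :
    Tendsto (fun N : ℕ => ((⌈N * x⌉₊ - 1 : ℕ) : ℝ) / N) atTop (nhds x) := by
  have hlim : Tendsto (fun N : ℕ => x - 1 / (N : ℝ)) atTop (nhds x) := by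
    simpa using tendsto_const_nhds.sub (tendsto_one_div_atTop_nhds_zero_nat (𝕜 := ℝ))
  refine tendsto_of_tendsto_of_tendsto_of_le_of_le' hlim tendsto_const_nhds ?_ ?_
  · filter_upwards [eventually_gt_atTop 0] with N hN
    have := (mem_gridCell_ceil hN hx).2
    rw [add_div] at this
    linarith
  · filter_upwards [eventually_gt_atTop 0] with N hN
    exact (mem_gridCell_ceil hN hx).1.le

lemma tendsto_ceil_div {x : ℝ} (hx : 0 < x) :
    Tendsto (fun N : ℕ => (((⌈N * x⌉₊ - 1 : ℕ) : ℝ) + 1) / N) atTop (nhds x) := by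
  simpa [add_div] using
    (tendsto_ceil_sub_one_div hx).add (tendsto_one_div_atTop_nhds_zero_nat (𝕜 := ℝ))

/-- Moving each element to the left endpoint of its cell only lowers the mass. -/
lemma Multisubset.sum_mul_count_gridCell_le (A : Multisubset) (N : ℕ) :
    ∑ m : Fin N, ENNReal.ofReal ((m : ℝ) / N) * A.count (gridCell N m) ≤ A.sum := by
  classical
  simp only [count_eq_tsum_indicator, ← ENNReal.tsum_mul_left]
  rw [← Summable.tsum_finsetSum fun _ _ => ENNReal.summable]
  refine ENNReal.tsum_le_tsum fun x => ?_
  by_cases hx : ∃ m : Fin N, x ∈ gridCell N m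
  · obtain ⟨m, hm⟩ := hx
    rw [Finset.sum_eq_single m]
    · rw [Set.indicator_of_mem hm, mul_comm]
      exact mul_le_mul_right (ENNReal.ofReal_le_ofReal hm.1.le) _
    · intro m' _ hne
      rw [Set.indicator_of_notMem fun h => hne (Fin.ext (eq_of_mem_gridCell h hm)), mul_zero]
    · simp
  · push Not at hx
    refine le_of_eq_of_le (Finset.sum_eq_zero fun m _ => ?_) zero_le
    rw [Set.indicator_of_notMem (hx m), mul_zero]

end Grid

/-! ### Good boxes and the minorant of the GEM density -/

section GoodBox

variable {k : ℕ}

/-- A box of the grid of mesh `1 / N` is good for `G` if it consists of distinct cells which satisfy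
the constraint on the sum of the endpoints, and if the ranked sequence of every multisubset of total
mass at most `1` that meets all these cells is in `G`. -/
def IsGoodBox (G : Set (ℕ → ℝ)) (N : ℕ) (m : Fin k → ℕ) : Prop :=
  Function.Injective m ∧ ∑ i, ((m i : ℝ) + 1) / N < 1 ∧
    ∀ A : Multisubset, A.sum ≤ 1 → (∀ i, A.count (gridCell N (m i)) ≠ 0) → A.ranked ∈ G

open Classical in
-- A nonzero term means that `A` meets every cell of a good box, so its ranking is in `G`; the
-- size-biased bound then controls the sum.
lemma sum_isGoodBox_le_indicator (G : Set (ℕ → ℝ)) (N k : ℕ) (A : Multisubset) (hA : A.sum ≤ 1) :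
    ∑ m : Fin k → Fin N, (if IsGoodBox G N (fun i => (m i : ℕ)) then
      gemDensity (fun i => ((m i : ℕ) : ℝ) / N) * (∏ i, ENNReal.ofReal (((m i : ℕ) : ℝ) / N)) *
        ∏ i, A.count (gridCell N (m i)) else 0) ≤ G.indicator 1 A.ranked := by
  by_cases hG : A.ranked ∈ G
  · rw [Set.indicator_of_mem hG, Pi.one_apply]
    refine le_trans (Finset.sum_le_sum fun m _ => ?_) (sum_gemDensity_mul_prod_le_one
      (p := fun m : Fin N => ((m : ℕ) : ℝ) / N) (fun m => by positivity)
      (c := fun m => A.count (gridCell N m)) (fun m => A.count_eq_zero_or_one_le _)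
      ((A.sum_mul_count_gridCell_le N).trans hA) k)
    split_ifs with h1 h2 h2
    · rw [Finset.prod_mul_distrib, mul_assoc]
      rfl
    · exact absurd (fun a b hab => h1.1 (congrArg Fin.val hab)) h2
    · exact zero_le
    · exact zero_le
  · refine le_of_eq_of_le (Finset.sum_eq_zero fun m _ => ?_) zero_le
    split_ifs with h
    · have : ∃ i, A.count (gridCell N (m i)) = 0 := by
        by_contra! hcon
        exact hG (h.2.2 A hA hcon)
      obtain ⟨i, hi⟩ := this
      exact mul_eq_zero_of_right _ (Finset.prod_eq_zero (Finset.mem_univ i) hi)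
    · rfl

/-- The density assigned to a box of the grid. -/
noncomputable def boxDensity (N : ℕ) (m : Fin k → ℕ) : ℝ≥0∞ :=
  gemDensity (fun i => (m i : ℝ) / N) * ∏ i, ENNReal.ofReal ((m i : ℝ) / (m i + 1))

open Classical in
/-- The piecewise constant minorant of the GEM density that is supported on the good boxes. -/
noncomputable def goodDensity (G : Set (ℕ → ℝ)) (N : ℕ) (x : Fin k → ℝ) : ℝ≥0∞ :=
  ∑ m : Fin k → Fin N, if IsGoodBox G N (fun i => (m i : ℕ)) then
    (Set.univ.pi fun i => gridCell N (m i)).indicator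
      (fun _ => boxDensity N fun i => (m i : ℕ)) x else 0

lemma measurableSet_box (N : ℕ) (m : Fin k → ℕ) :
    MeasurableSet (Set.univ.pi fun i => gridCell N (m i)) :=
  MeasurableSet.univ_pi fun i => measurableSet_gridCell N (m i)

lemma measurable_goodDensity (G : Set (ℕ → ℝ)) (N : ℕ) :
    Measurable (goodDensity G N : (Fin k → ℝ) → ℝ≥0∞) := by
  classical
  unfold goodDensity
  refine Finset.measurable_fun_sum _ fun m _ => ?_
  split_ifs
  · exact measurable_const.indicator (measurableSet_box N fun i => (m i : ℕ))
  · exact measurable_const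

open Classical in
-- The factor `m / (m + 1)` in `boxDensity` is made for this: times the cell length `1 / N`, it is
-- the size `m / N` times `1 / (m + 1)`, the value of `(b - a) / b` on the cell.
lemma lintegral_goodDensity (G : Set (ℕ → ℝ)) (N : ℕ) :
    ∫⁻ x : Fin k → ℝ, goodDensity G N x
      = ∑ m : Fin k → Fin N, if IsGoodBox G N (fun i => (m i : ℕ)) then
        gemDensity (fun i => ((m i : ℕ) : ℝ) / N) * (∏ i, ENNReal.ofReal (((m i : ℕ) : ℝ) / N)) *
          ENNReal.ofReal (∏ i, (((m i : ℕ) : ℝ) + 1)⁻¹) else 0 := by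
  unfold goodDensity
  rw [lintegral_finsetSum]
  · refine Finset.sum_congr rfl fun m _ => ?_
    split_ifs
    · rw [lintegral_indicator_const (measurableSet_box N fun i => (m i : ℕ)), volume_pi_pi,
        boxDensity, mul_assoc, mul_assoc,
        ENNReal.ofReal_prod_of_nonneg fun i _ => by positivity,
        ← Finset.prod_mul_distrib, ← Finset.prod_mul_distrib]
      congr 1
      refine Finset.prod_congr rfl fun i _ => ?_
      rw [gridCell, Real.volume_Ioc, ← ENNReal.ofReal_mul (by positivity),
        ← ENNReal.ofReal_mul (by positivity)]
      congr 1
      ring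
    · simp
  · intro m _
    split_ifs
    · exact measurable_const.indicator (measurableSet_box N fun i => (m i : ℕ))
    · exact measurable_const

lemma boxDensity_le_goodDensity {G : Set (ℕ → ℝ)} {N : ℕ} {m : Fin k → ℕ} (hm : ∀ i, m i < N)
    (hgood : IsGoodBox G N m) {x : Fin k → ℝ} (hx : ∀ i, x i ∈ gridCell N (m i)) :
    boxDensity N m ≤ goodDensity G N x := by
  classical
  unfold goodDensity
  refine le_trans (le_of_eq ?_) (Finset.single_le_sum (fun _ _ => zero_le)
    (Finset.mem_univ (fun i => (⟨m i, hm i⟩ : Fin N))))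
  rw [if_pos hgood, Set.indicator_of_mem]
  exact fun i _ => hx i

lemma tendsto_boxDensity {x : Fin k → ℝ} (hx : ∀ i, 0 < x i) (h1 : ∑ i, x i < 1) :
    Tendsto (fun N : ℕ => boxDensity N fun i => ⌈N * x i⌉₊ - 1) atTop (nhds (gemDensity x)) := by
  have hdens : Tendsto (fun N : ℕ => gemDensity fun i => ((⌈N * x i⌉₊ - 1 : ℕ) : ℝ) / N) atTop
      (nhds (gemDensity x)) :=
    (continuousAt_gemDensity (fun i => (hx i).le) h1).tendsto.comp
      (tendsto_pi_nhds.2 fun i => tendsto_ceil_sub_one_div (hx i))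
  have hprod : Tendsto (fun N : ℕ => ∏ i : Fin k, ENNReal.ofReal
      (((⌈N * x i⌉₊ - 1 : ℕ) : ℝ) / ((⌈N * x i⌉₊ - 1 : ℕ) + 1))) atTop (nhds (∏ _i : Fin k, 1)) := by
    refine ENNReal.tendsto_finsetProd_of_ne_top _ (fun i _ => ?_) fun _ _ => ENNReal.one_ne_top
    rw [← ENNReal.ofReal_one]
    refine (ENNReal.continuous_ofReal.tendsto _).comp ?_
    have h := (tendsto_ceil_sub_one_div (hx i)).div (tendsto_ceil_div (hx i)) (hx i).ne'
    rw [div_self (hx i).ne'] at h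
    refine h.congr' ?_
    filter_upwards [eventually_gt_atTop 0] with N hN
    have hN' : (N : ℝ) ≠ 0 := by exact_mod_cast hN.ne'
    simp only [Pi.div_apply]
    rw [div_div_div_cancel_right₀ hN']
  simpa [boxDensity] using ENNReal.Tendsto.mul hdens (Or.inr (by simp)) hprod
    (Or.inr (gemDensity_ne_top x))

/-- Uniform convergence implies coordinatewise convergence. -/
lemma exists_forall_abs_sub_le_mem {G : Set (ℕ → ℝ)} (hG : IsOpen G) {y : ℕ → ℝ} (hy : y ∈ G) :
    ∃ η > 0, ∀ z : ℕ → ℝ, (∀ i, |z i - y i| ≤ η) → z ∈ G := by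
  by_contra! hcon
  choose z hz hzG using fun n : ℕ => hcon (1 / ((n : ℝ) + 1)) Nat.one_div_pos_of_nat
  have hlim : Tendsto z atTop (nhds y) := by
    refine tendsto_pi_nhds.2 fun i => tendsto_iff_dist_tendsto_zero.2 ?_
    exact squeeze_zero (fun _ => dist_nonneg) (fun n => hz n i)
      tendsto_one_div_add_atTop_nhds_zero_nat
  obtain ⟨n, hn⟩ := (hlim.eventually (hG.mem_nhds hy)).exists
  exact hzG n hn

/-- On a fine grid the distinct terms fall in distinct cells, and the left endpoints still sum to
more than `1 - η`. Elements in these cells therefore leave mass less than `η`, so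
`abs_ranked_sub_rankedSeq_le` applies. -/
lemma eventually_isGoodBox {G : Set (ℕ → ℝ)} {g : ℕ → ℝ} (hpos : ∀ i, 0 < g i)
    (hg1 : ∀ i, g i ≤ 1) (hinj : Function.Injective g) {η : ℝ} (hη : 0 < η)
    (hG : ∀ z : ℕ → ℝ, (∀ i, |z i - rankedSeq g i| ≤ η) → z ∈ G)
    (hsum : ∑ i : Fin k, g i < 1) (hsum' : 1 < η + ∑ i : Fin k, g i)
    (htail : ∀ i, k ≤ i → g i ≤ η) :
    ∀ᶠ N : ℕ in atTop, IsGoodBox G N fun i : Fin k => ⌈N * g i⌉₊ - 1 := by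
  have hsep : ∀ᶠ N : ℕ in atTop, ∀ i j : Fin k, i ≠ j → 1 / (N : ℝ) < |g i - g j| := by
    refine eventually_all.2 fun i => eventually_all.2 fun j => ?_
    by_cases hij : i = j
    · simp [hij]
    · have : 0 < |g i - g j| := abs_pos.2 (sub_ne_zero.2 fun h => hij (Fin.ext (hinj h)))
      filter_upwards [(tendsto_one_div_atTop_nhds_zero_nat (𝕜 := ℝ)).eventually_lt_const this]
        with N hN _ using hN
  have hup : ∀ᶠ N : ℕ in atTop, ∑ i : Fin k, (((⌈N * g i⌉₊ - 1 : ℕ) : ℝ) + 1) / N < 1 :=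
    (tendsto_finsetSum Finset.univ fun (i : Fin k) _ => tendsto_ceil_div (hpos i))
      |>.eventually_lt_const hsum
  have hlow : ∀ᶠ N : ℕ in atTop, 1 - η < ∑ i : Fin k, ((⌈N * g i⌉₊ - 1 : ℕ) : ℝ) / N :=
    (tendsto_finsetSum Finset.univ fun (i : Fin k) _ =>
      tendsto_ceil_sub_one_div (hpos i)).eventually_const_lt
      (by linarith)
  filter_upwards [hsep, hup, hlow, eventually_gt_atTop 0,
    (tendsto_one_div_atTop_nhds_zero_nat (𝕜 := ℝ)).eventually_lt_const hη] with N h1 h2 h3 hN h4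
  have hmem : ∀ i : Fin k, g i ∈ gridCell N (⌈N * g i⌉₊ - 1) :=
    fun i => mem_gridCell_ceil hN (hpos i)
  have hminj : Function.Injective fun i : Fin k => ⌈N * g i⌉₊ - 1 := by
    intro i j hij
    by_contra hne
    have hj := hmem j
    simp only at hij
    rw [← hij] at hj
    exact absurd (abs_sub_le_of_mem_gridCell (hmem i) hj) (not_le.2 (h1 i j hne))
  refine ⟨hminj, h2, fun A hA hcount => hG _ fun l => ?_⟩
  choose a ha hma using fun i => A.exists_mem_of_count_ne_zero (hcount i)
  refine abs_ranked_sub_rankedSeq_le A hA (a := a) (fun i j hij => hminj ?_) hma hg1 hη.le ?_ htail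
    (fun i => (abs_sub_le_of_mem_gridCell (ha i) (hmem i)).trans h4.le) l
  · have hj := ha j
    rw [← hij] at hj
    exact eq_of_mem_gridCell (ha i) hj
  · have : ∑ i : Fin k, ((⌈N * g i⌉₊ - 1 : ℕ) : ℝ) / N ≤ ∑ i, a i :=
      Finset.sum_le_sum fun i _ => (ha i).1.le
    linarith

end GoodBox

/-! ### Passage to the limit -/

section Limit

lemma sum_mul_le_liminf {ι : Type*} (s : Finset ι) {c m : ι → ℝ≥0∞} {X : ι → ℕ → ℝ≥0∞}
    (hc : ∀ i ∈ s, c i ≠ ∞) (h : ∀ i ∈ s, m i ≤ liminf (X i) atTop) :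
    ∑ i ∈ s, c i * m i ≤ liminf (fun n => ∑ i ∈ s, c i * X i n) atTop := by
  have hterm : ∀ i ∈ s, c i * m i ≤ liminf (fun n => c i * X i n) atTop := fun i hi => by
    rw [ENNReal.liminf_const_mul_of_ne_top (hc i hi)]
    exact mul_le_mul_right (h i hi) _
  -- Superadditivity of `liminf` over a finite sum is Fatou for counting measure.
  have hfatou := lintegral_liminf_le (μ := (@Measure.count s ⊤)) (u := (atTop : Filter ℕ))
    (f := fun n i => c i * X i n) fun n => measurable_from_top
  simp only [lintegral_count' measurable_from_top, tsum_fintype] at hfatou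
  calc ∑ i ∈ s, c i * m i = ∑ i : s, c i * m i := (Finset.sum_coe_sort s fun i => c i * m i).symm
    _ ≤ ∑ i : s, liminf (fun n => c i * X i n) atTop :=
        Finset.sum_le_sum fun i _ => hterm i i.2
    _ ≤ liminf (fun n => ∑ i : s, c i * X i n) atTop := hfatou
    _ = liminf (fun n => ∑ i ∈ s, c i * X i n) atTop := by
        congr 1
        ext n
        exact Finset.sum_coe_sort s fun i => c i * X i n

variable {Ω : ℕ → Type*} [∀ n, MeasurableSpace (Ω n)] {P : ∀ n, Measure (Ω n)}
  {A : ∀ n, Ω n → Multisubset}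

lemma le_liminf_gridCell
    (hE : ∀ (k : ℕ), 1 ≤ k → ∀ (a b : Fin k → ℝ), AdmissibleIntervals a b →
      ENNReal.ofReal (∏ i, (b i - a i) / b i) ≤
        liminf (fun n => ∫⁻ ω, ∏ i, (A n ω).count (Set.Icc (a i) (b i)) ∂(P n)) atTop)
    {k N : ℕ} (hk : 1 ≤ k) {m : Fin k → ℕ} (hm : ∀ i, m i < N) (hinj : Function.Injective m)
    (hsum : ∑ i, ((m i : ℝ) + 1) / N < 1) :
    ENNReal.ofReal (∏ i, ((m i : ℝ) + 1)⁻¹) ≤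
      liminf (fun n => ∫⁻ ω, ∏ i, (A n ω).count (gridCell N (m i)) ∂(P n)) atTop := by
  have hN : (0 : ℝ) < N := by exact_mod_cast (Nat.zero_le _).trans_lt (hm ⟨0, hk⟩)
  -- Adjacent closed cells share an endpoint and the cell `m = 0` touches 0, so each cell is
  -- shortened on the left by `δ / N`; the ratio becomes `(1 - δ) / (m + 1)`.
  have hlim : Tendsto (fun δ : ℝ => ENNReal.ofReal (∏ i, (1 - δ) * ((m i : ℝ) + 1)⁻¹))
      (nhdsWithin 0 (Set.Ioi 0)) (nhds (ENNReal.ofReal (∏ i, ((m i : ℝ) + 1)⁻¹))) := by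
    have : Continuous fun δ : ℝ => ENNReal.ofReal (∏ i, (1 - δ) * ((m i : ℝ) + 1)⁻¹) :=
      ENNReal.continuous_ofReal.comp (by fun_prop)
    simpa using (this.tendsto 0).mono_left nhdsWithin_le_nhds
  refine le_of_tendsto hlim ?_
  filter_upwards [Ioo_mem_nhdsGT (zero_lt_one (α := ℝ))] with δ hδ
  have hsub : ∀ i, Set.Icc (((m i : ℝ) + δ) / N) (((m i : ℝ) + 1) / N) ⊆ gridCell N (m i) := by
    intro i x hx
    refine ⟨lt_of_lt_of_le ?_ hx.1, hx.2⟩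
    exact (div_lt_div_iff_of_pos_right hN).2 (by linarith [hδ.1])
  have hadm : AdmissibleIntervals (fun i => ((m i : ℝ) + δ) / N)
      (fun i => ((m i : ℝ) + 1) / N) := by
    refine ⟨fun i => ?_, fun i => ?_, fun i => ?_, fun i j hij => ?_, hsum⟩
    · have := hδ.1
      positivity
    · exact (div_lt_div_iff_of_pos_right hN).2 (by linarith [hδ.2])
    · rw [div_le_one hN]
      exact_mod_cast hm i
    · exact Set.disjoint_left.2 fun x hx hx' =>
        hij (hinj (eq_of_mem_gridCell (hsub i hx) (hsub j hx')))
  have hprod : ∏ i, (1 - δ) * ((m i : ℝ) + 1)⁻¹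
      = ∏ i, (((m i : ℝ) + 1) / N - ((m i : ℝ) + δ) / N) / (((m i : ℝ) + 1) / N) := by
    refine Finset.prod_congr rfl fun i _ => ?_
    have : (m i : ℝ) + 1 ≠ 0 := by positivity
    field_simp
    ring
  rw [hprod]
  refine (hE k hk _ _ hadm).trans (liminf_le_liminf (Eventually.of_forall fun n => ?_))
  exact lintegral_mono fun ω => Finset.prod_le_prod' fun i _ => (A n ω).count_mono (hsub i)

lemma lintegral_goodDensity_le_liminf (hA : ∀ n, Measurable (A n))
    (hT : ∀ n, ∀ᵐ ω ∂(P n), (A n ω).sum ≤ 1)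
    (hE : ∀ (k : ℕ), 1 ≤ k → ∀ (a b : Fin k → ℝ), AdmissibleIntervals a b →
      ENNReal.ofReal (∏ i, (b i - a i) / b i) ≤
        liminf (fun n => ∫⁻ ω, ∏ i, (A n ω).count (Set.Icc (a i) (b i)) ∂(P n)) atTop)
    {G : Set (ℕ → ℝ)} (hG : MeasurableSet G) {k : ℕ} (hk : 1 ≤ k) (N : ℕ) :
    ∫⁻ x : Fin k → ℝ, goodDensity G N x
      ≤ liminf (fun n => P n ((fun ω => (A n ω).ranked) ⁻¹' G)) atTop := by
  classical
  rw [lintegral_goodDensity, ← Finset.sum_filter]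
  refine (sum_mul_le_liminf _ (X := fun (m : Fin k → Fin N) n =>
    ∫⁻ ω, ∏ i, (A n ω).count (gridCell N (m i)) ∂(P n)) (fun m _ => ?_) fun m hm => ?_).trans ?_
  · exact ENNReal.mul_ne_top (gemDensity_ne_top _)
      (ENNReal.prod_ne_top fun _ _ => ENNReal.ofReal_ne_top)
  · have hgood := (Finset.mem_filter.1 hm).2
    exact le_liminf_gridCell hE hk (fun i => (m i).2) hgood.1 hgood.2.1
  · refine liminf_le_liminf (Eventually.of_forall fun n => ?_)
    have hmeas : ∀ m : Fin k → Fin N,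
        Measurable fun ω => ∏ i, (A n ω).count (gridCell N (m i)) := fun m =>
      Finset.measurable_fun_prod _ fun i _ =>
        (Multisubset.measurable_count (measurableSet_gridCell N (m i))).comp (hA n)
    have hGm : MeasurableSet ((fun ω => (A n ω).ranked) ⁻¹' G) :=
      (Multisubset.measurable_ranked.comp (hA n)) hG
    simp only [← lintegral_const_mul _ (hmeas _)]
    rw [← lintegral_finsetSum _ fun m _ => (hmeas m).const_mul _, ← lintegral_indicator_one hGm]
    refine lintegral_mono_ae ?_
    filter_upwards [hT n] with ω hω
    rw [Finset.sum_filter]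
    exact sum_isGoodBox_le_indicator G N k (A n ω) hω

lemma ae_eventually_gemDensity_le {G : Set (ℕ → ℝ)} (hG : IsOpen G) :
    ∀ᵐ u ∂iidUniform, pdSeq 1 u ∈ G → ∀ᶠ k : ℕ in atTop,
      gemDensity (fun i : Fin k => gemSeq 1 u i)
          ≤ liminf (fun N => goodDensity G N fun i : Fin k => gemSeq 1 u i) atTop ∧
        gemDensity (fun i : Fin k => gemSeq 1 u i) ≠ 0 := by
  filter_upwards [ae_iidUniform_mem_Ioo, ae_tendsto_prod_range, ae_injective_gemSeq]
    with u hu hlim hinj hmem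
  obtain ⟨η, hη, hball⟩ := exists_forall_abs_sub_le_mem hG hmem
  have hpos : ∀ i, 0 < gemSeq 1 u i := fun i => by
    rw [gemSeq_one_apply]
    exact mul_pos (Finset.prod_pos fun j _ => (hu j).1) (by linarith [(hu i).2])
  filter_upwards [hlim.eventually_lt_const hη] with k hk
  have hs : ∑ i : Fin k, gemSeq 1 u i = 1 - ∏ j ∈ Finset.range k, (u j : ℝ) := by
    rw [← Finset.sum_range (fun i => gemSeq 1 u i), sum_range_gemSeq_one]
  have hr : 0 < ∏ j ∈ Finset.range k, (u j : ℝ) := Finset.prod_pos fun j _ => (hu j).1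
  have hs1 : ∑ i : Fin k, gemSeq 1 u i < 1 := by linarith
  refine ⟨?_, gemDensity_ne_zero (fun i => (hpos i).le) hs1⟩
  rw [← (tendsto_boxDensity (x := fun i : Fin k => gemSeq 1 u i) (fun i => hpos i) hs1).liminf_eq]
  refine liminf_le_liminf ?_
  filter_upwards [eventually_isGoodBox hpos (gemSeq_one_le_one u) hinj hη hball hs1
    (by linarith) (fun i hi => (gemSeq_one_le_prod u hi).trans hk.le), eventually_gt_atTop 0]
    with N hgood hN
  exact boxDensity_le_goodDensity (fun i => ceil_sub_one_lt hN (gemSeq_one_le_one u i)) hgood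
    fun i => mem_gridCell_ceil hN (hpos i)

/-- The ratio of the limiting minorant to the GEM density has mean at most `ℓ`, and almost surely on
the event it is eventually at least 1 as `k` grows. -/
lemma measure_pdSeq_le_of_lintegral_goodDensity_le {G : Set (ℕ → ℝ)} (hG : IsOpen G) {ℓ : ℝ≥0∞}
    (h : ∀ k : ℕ, 1 ≤ k → ∀ N, ∫⁻ x : Fin k → ℝ, goodDensity G N x ≤ ℓ) :
    iidUniform (pdSeq 1 ⁻¹' G) ≤ ℓ := by
  let Φ : ∀ k : ℕ, (Fin k → ℝ) → ℝ≥0∞ := fun k x => liminf (fun N => goodDensity G N x) atTop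
  have hΦm : ∀ k, Measurable (Φ k) := fun k => Measurable.liminf fun N => measurable_goodDensity G N
  let F : ℕ → (ℕ → unitInterval) → ℝ≥0∞ := fun k u =>
    (Φ k fun i => gemSeq 1 u i) / gemDensity fun i : Fin k => gemSeq 1 u i
  have hrestr : ∀ n, Measurable fun u : ℕ → unitInterval => fun i : Fin n => gemSeq 1 u i :=
    fun n => measurable_pi_lambda _ fun i =>
      (measurable_pi_apply (i : ℕ)).comp measurable_gemSeq_one
  have hFm : ∀ k, Measurable (F k) := fun k =>
    ((hΦm k).div measurable_gemDensity).comp (hrestr k)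
  have hF : ∀ k, 1 ≤ k → ∫⁻ u, F k u ∂iidUniform ≤ ℓ := by
    intro k hk
    calc ∫⁻ u, F k u ∂iidUniform ≤ ∫⁻ x, gemDensity x * (Φ k x / gemDensity x) :=
          lintegral_gemSeq_le k ((hΦm k).div measurable_gemDensity)
      _ ≤ ∫⁻ x, Φ k x := lintegral_mono fun x => ENNReal.mul_div_le
      _ ≤ liminf (fun N => ∫⁻ x : Fin k → ℝ, goodDensity G N x) atTop :=
          lintegral_liminf_le fun N => measurable_goodDensity G N
      _ ≤ liminf (fun _ : ℕ => ℓ) atTop := liminf_le_liminf (Eventually.of_forall (h k hk))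
      _ = ℓ := liminf_const ℓ
  have hm : MeasurableSet (pdSeq 1 ⁻¹' G) := measurable_pdSeq_one hG.measurableSet
  calc iidUniform (pdSeq 1 ⁻¹' G) = ∫⁻ u, (pdSeq 1 ⁻¹' G).indicator 1 u ∂iidUniform :=
        (lintegral_indicator_one hm).symm
    _ ≤ ∫⁻ u, liminf (fun k => F k u) atTop ∂iidUniform := by
        refine lintegral_mono_ae ?_
        filter_upwards [ae_eventually_gemDensity_le hG] with u hu
        by_cases hmem : u ∈ pdSeq 1 ⁻¹' G
        · rw [Set.indicator_of_mem hmem]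
          refine le_liminf_of_le (by isBoundedDefault) ?_
          filter_upwards [hu hmem] with k hk
          rw [Pi.one_apply, ENNReal.le_div_iff_mul_le (Or.inl hk.2)
            (Or.inl (gemDensity_ne_top _)), one_mul]
          exact hk.1
        · rw [Set.indicator_of_notMem hmem]
          exact zero_le
    _ ≤ liminf (fun k => ∫⁻ u, F k u ∂iidUniform) atTop := lintegral_liminf_le hFm
    _ ≤ liminf (fun _ : ℕ => ℓ) atTop := by
        refine liminf_le_liminf ?_
        filter_upwards [eventually_ge_atTop 1] with k hk using hF k hk
    _ = ℓ := liminf_const ℓ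

/-- From `1 - 1/t ≤ log t` at `t = b / a`; hence the logarithmic assumption is the stronger one. -/
lemma AdmissibleIntervals.prod_div_le_prod_log {k : ℕ} {a b : Fin k → ℝ}
    (h : AdmissibleIntervals a b) : ∏ i, (b i - a i) / b i ≤ ∏ i, Real.log (b i / a i) := by
  refine Finset.prod_le_prod (fun i _ => ?_) fun i _ => ?_
  · exact div_nonneg (by linarith [h.lt i]) ((h.pos i).trans (h.lt i)).le
  · have hb := (h.pos i).trans (h.lt i)
    have := Real.one_sub_inv_le_log_of_pos (div_pos hb (h.pos i))
    rwa [inv_div, one_sub_div hb.ne'] at this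

end Limit

theorem lemma3p1 {Ω : ℕ → Type*} [∀ n, MeasurableSpace (Ω n)]
    (P : ∀ n, Measure (Ω n)) [∀ n, IsProbabilityMeasure (P n)]
    (A : ∀ n, Ω n → Multisubset) (hA : ∀ n, Measurable (A n))
    (hT : ∀ n, ∀ᵐ ω ∂(P n), (A n ω).sum ≤ 1)
    (hE : (∀ (k : ℕ), 1 ≤ k → ∀ (a b : Fin k → ℝ), AdmissibleIntervals a b →
            ENNReal.ofReal (∏ i, (b i - a i) / b i) ≤
              liminf (fun n => ∫⁻ ω, ∏ i, (A n ω).count (Set.Icc (a i) (b i)) ∂(P n)) atTop) ∨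
          (∀ (k : ℕ), 1 ≤ k → ∀ (a b : Fin k → ℝ), AdmissibleIntervals a b →
            ENNReal.ofReal (∏ i, Real.log (b i / a i)) ≤
              liminf (fun n => ∫⁻ ω, ∏ i, (A n ω).count (Set.Icc (a i) (b i)) ∂(P n)) atTop)) :
    TendstoInDistribution (fun n ω => (A n ω).ranked) atTop (pdSeq 1) P iidUniform := by
  have hE' : ∀ (k : ℕ), 1 ≤ k → ∀ (a b : Fin k → ℝ), AdmissibleIntervals a b →
      ENNReal.ofReal (∏ i, (b i - a i) / b i) ≤
        liminf (fun n => ∫⁻ ω, ∏ i, (A n ω).count (Set.Icc (a i) (b i)) ∂(P n)) atTop := by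
    rcases hE with hE | hE
    · exact hE
    · exact fun k hk a b hab =>
        (ENNReal.ofReal_le_ofReal hab.prod_div_le_prod_log).trans (hE k hk a b hab)
  have hm : ∀ n, Measurable fun ω => (A n ω).ranked := fun n =>
    Multisubset.measurable_ranked.comp (hA n)
  refine ⟨fun n => (hm n).aemeasurable, measurable_pdSeq_one.aemeasurable, ?_⟩
  refine tendsto_of_forall_isOpen_le_liminf' fun G hG => ?_
  simp only [ProbabilityMeasure.coe_mk, Measure.map_apply measurable_pdSeq_one hG.measurableSet,
    Measure.map_apply (hm _) hG.measurableSet]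
  exact measure_pdSeq_le_of_lintegral_goodDensity_le hG fun k hk N =>
    lintegral_goodDensity_le_liminf hA hT hE' hG.measurableSet hk N
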